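/- For integers $0\le i\le n$ let ${n \brack i}$ denote the unsigned Stirling number of the first kind, and for $s\in\mathbb{C}$ let $(s)_i=\prod_{j=1}^{i}(s-j+1)$ be the falling factorial. For an integer $n\ge 1$, a complex number $s$ and a real number $p\geq 1$, let \[ g_n(s,p)=\sum_{i=1}^{n}{n \brack i}\frac{(s)_i}{p^i}. \] Then for every real $p\ge 1$ and every $s\in\mathbb{C}$, the integral $\int_1^\infty e^{-up}u^s\,du$ and the series $\sum_{n=1}^\infty \frac{g_n(s,p)}{(n+1)!}$ both converge absolutely, and \[ \int_1^\infty e^{-up}u^s\,du=\frac{e^{-p}}{p}\left(1+\sum_{n=1}^\infty\frac{g_n(s,p)}{(n+1)!}\right). \] -/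

import Mathlib

/-- `g_n(s, p) = ∑_{i=1}^n [n, i] (s)_i / p^i`, where `[n, i]` is the unsigned Stirling number of
the first kind and `(s)_i = s (s - 1) ⋯ (s - i + 1)` is the falling factorial. -/
noncomputable def stirlingG (n : ℕ) (s : ℂ) (p : ℝ) : ℂ :=
  ∑ i ∈ Finset.Icc 1 n,
    (Nat.stirlingFirst n i : ℂ) * ((descPochhammer ℂ i).eval s / (p : ℂ) ^ i)

/-!
Put `f z = (1 - log (1 - z) / p) ^ s`. The Taylor coefficients of `f` at `0` are `g_n(s, p) / n!`
(with `1` for `n = 0`), and the substitution `u = 1 - log (1 - x) / p` turns the integral into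
`(e^{-p} / p) ∫₀¹ f(x) dx`; so it remains to integrate the Taylor series term by term, which is
permitted once its coefficients `a_n` satisfy `∑ ‖a_n‖ / (n + 1) < ∞`.

On the unit disc `|1 - z| < 2` and `|arg (1 - z)| ≤ π / 2`, so for `p > log 2` the base of the power
stays in a half-strip `re ≥ δ > 0`, `|im| ≤ b`. There `‖w ^ s‖ ^ 2` is at most a constant times
`exp (2 ε re w)` for every `ε > 0`, and for small `ε` this exponential is at most twice the real
part of `exp (2 ε w)`. Thus `‖f‖ ^ 2` is bounded by a harmonic function, and comparing the two on
circles of radius `r → 1` (Parseval on one side, the mean value property on the other) gives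
`∑ ‖a_n‖ ^ 2 < ∞`, whence `∑ ‖a_n‖ / (n + 1) < ∞` by Cauchy's inequality.
-/

open MeasureTheory Set Metric Filter
open scoped Real Topology

section StirlingDerivatives

theorem sum_stirlingFirst_succ_mul {R : Type*} [CommSemiring R] (n : ℕ) (w : ℕ → R) :
    ∑ i ∈ Finset.range (n + 2), (Nat.stirlingFirst (n + 1) i : R) * w i =
      n * ∑ i ∈ Finset.range (n + 1), (Nat.stirlingFirst n i : R) * w i +
        ∑ i ∈ Finset.range (n + 1), (Nat.stirlingFirst n i : R) * w (i + 1) := by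
  have hextend : ∑ i ∈ Finset.range (n + 1), (Nat.stirlingFirst n i : R) * w i =
      ∑ i ∈ Finset.range (n + 2), (Nat.stirlingFirst n i : R) * w i := by
    simp [Finset.sum_range_succ _ (n + 1), Nat.stirlingFirst_eq_zero_of_lt (Nat.lt_succ_self n)]
  have hzero : (n : R) * (Nat.stirlingFirst n 0 : R) = 0 := by
    cases n <;> simp [Nat.stirlingFirst_succ_zero]
  rw [hextend, Finset.sum_range_succ' _ (n + 1), Finset.sum_range_succ' _ (n + 1), mul_add,
    ← mul_assoc, hzero, Nat.stirlingFirst_succ_zero, Finset.mul_sum]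
  simp only [Nat.cast_zero, zero_mul, add_zero]
  rw [← Finset.sum_add_distrib]
  refine Finset.sum_congr rfl fun i _ => ?_
  rw [Nat.stirlingFirst_succ_succ]
  push_cast
  ring

/- If `D = (1 - z) d/dz`, then `(1 - z) ^ n (d/dz) ^ n = D (D + 1) ⋯ (D + n - 1)`, and the
coefficients of the rising factorial are the Stirling numbers of the first kind. -/
theorem iteratedDeriv_eqOn_sum_stirlingFirst_div {𝕜 : Type*} [NontriviallyNormedField 𝕜]
    {U : Set 𝕜} (hU : IsOpen U) (h1 : (1 : 𝕜) ∉ U) {φ : ℕ → 𝕜 → 𝕜}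
    (hφ : ∀ i, ∀ z ∈ U, HasDerivAt (φ i) (φ (i + 1) z / (1 - z)) z) (n : ℕ) :
    EqOn (iteratedDeriv n (φ 0))
      (fun z => (∑ i ∈ Finset.range (n + 1), (Nat.stirlingFirst n i : 𝕜) * φ i z) / (1 - z) ^ n)
      U := by
  induction n with
  | zero => intro z _; simp
  | succ n ih =>
    intro z hz
    have hz1 : 1 - z ≠ 0 := sub_ne_zero.2 fun h => h1 (h ▸ hz)
    have hsum : HasDerivAt
        (fun z => ∑ i ∈ Finset.range (n + 1), (Nat.stirlingFirst n i : 𝕜) * φ i z)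
        ((∑ i ∈ Finset.range (n + 1), (Nat.stirlingFirst n i : 𝕜) * φ (i + 1) z) / (1 - z)) z := by
      simpa only [Finset.sum_div, mul_div_assoc] using
        HasDerivAt.fun_sum fun i _ => (hφ i z hz).const_mul (Nat.stirlingFirst n i : 𝕜)
    have hquot := hsum.fun_div (((hasDerivAt_id' z).const_sub 1).fun_pow n) (pow_ne_zero n hz1)
    rw [iteratedDeriv_succ, (ih.eventuallyEq_of_mem (hU.mem_nhds hz)).deriv_eq, hquot.deriv]
    beta_reduce
    rw [sum_stirlingFirst_succ_mul n (φ · z)]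
    rcases n with _ | n
    · simp
    · rw [Nat.add_sub_cancel]
      field_simp
      push_cast
      ring

end StirlingDerivatives

section SquareSummableCoefficients

theorem fourierCoeffOn_comp_circleMap {f : ℂ → ℂ} {c : ℂ} {r : ℝ} (hr : 0 < r)
    (hf : DiffContOnCl ℂ f (ball c r)) (n : ℕ) :
    fourierCoeffOn Real.two_pi_pos (fun θ => f (circleMap c r θ)) n =
      iteratedDeriv n f c / n.factorial * r ^ n := by
  have hr0 : (r : ℂ) ≠ 0 := Complex.ofReal_ne_zero.2 hr.ne'
  have hkernel (θ : ℝ) : deriv (circleMap c r) θ • (1 / (circleMap c r θ - c) ^ (n + 1)) •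
      f (circleMap c r θ) = Complex.I / r ^ n *
        (fourier (-n : ℤ) (θ : AddCircle (2 * π - 0)) • f (circleMap c r θ)) := by
    have hfourier : fourier (-n : ℤ) (θ : AddCircle (2 * π - 0)) =
        (Complex.exp (θ * Complex.I) ^ n)⁻¹ := by
      rw [fourier_coe_apply, ← Complex.exp_nat_mul, ← Complex.exp_neg]
      congr 1
      push_cast
      field_simp
      ring
    rw [hfourier, deriv_circleMap, circleMap_sub_center, circleMap_zero]
    simp only [smul_eq_mul]
    field_simp
    ring
  have hcauchy := hf.circleIntegral_one_div_sub_center_pow_smul hr n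
  simp only [circleIntegral, hkernel, intervalIntegral.integral_const_mul] at hcauchy
  rw [div_mul_eq_mul_div, div_eq_iff (pow_ne_zero n hr0), smul_eq_mul] at hcauchy
  have hintegral : (∫ θ in (0 : ℝ)..2 * π, fourier (-n : ℤ) (θ : AddCircle (2 * π - 0)) •
      f (circleMap c r θ)) = 2 * π * (iteratedDeriv n f c / n.factorial * r ^ n) :=
    mul_left_cancel₀ Complex.I_ne_zero (by linear_combination hcauchy)
  rw [fourierCoeffOn_eq_integral, hintegral, sub_zero, Complex.real_smul]
  push_cast
  field_simp

theorem sum_sq_norm_taylorCoeff_le_circleAverage {f : ℂ → ℂ} {c : ℂ} {r : ℝ} (hr : 0 < r)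
    (hf : DiffContOnCl ℂ f (ball c r)) (N : ℕ) :
    ∑ n ∈ Finset.range N, (‖iteratedDeriv n f c / n.factorial‖ * r ^ n) ^ 2 ≤
      Real.circleAverage (fun z => ‖f z‖ ^ 2) c r := by
  have hcont : Continuous fun θ : ℝ => f (circleMap c r θ) :=
    hf.continuousOn_ball.comp_continuous (by fun_prop) (circleMap_mem_closedBall c hr.le)
  have hL2 : MemLp (fun θ : ℝ => f (circleMap c r θ)) 2 (volume.restrict (Ioc 0 (2 * π))) := by
    obtain ⟨C, hC⟩ := isCompact_Icc.exists_bound_of_continuousOn hcont.continuousOn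
    exact .of_bound hcont.aestronglyMeasurable C
      (ae_restrict_of_forall_mem measurableSet_Ioc fun θ hθ => hC θ (Ioc_subset_Icc_self hθ))
  have hparseval : HasSum
      (fun n : ℤ => ‖fourierCoeffOn Real.two_pi_pos (fun θ => f (circleMap c r θ)) n‖ ^ 2)
      (Real.circleAverage (fun z => ‖f z‖ ^ 2) c r) := by
    simpa only [Real.circleAverage_def, sub_zero] using
      hasSum_sq_fourierCoeffOn Real.two_pi_pos hL2
  calc ∑ n ∈ Finset.range N, (‖iteratedDeriv n f c / n.factorial‖ * r ^ n) ^ 2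
      = ∑ n ∈ (Finset.range N).map Nat.castEmbedding,
          ‖fourierCoeffOn Real.two_pi_pos (fun θ => f (circleMap c r θ)) n‖ ^ 2 := by
        simp only [Finset.sum_map, Nat.castEmbedding_apply, fourierCoeffOn_comp_circleMap hr hf,
          norm_mul, norm_pow, Complex.norm_real, Real.norm_of_nonneg hr.le]
    _ ≤ Real.circleAverage (fun z => ‖f z‖ ^ 2) c r :=
        sum_le_hasSum _ (fun _ _ => sq_nonneg _) hparseval

theorem summable_sq_norm_taylorCoeff_of_sq_norm_le_re {f G : ℂ → ℂ} {c : ℂ} {R : ℝ} (hR : 0 < R)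
    (hf : DifferentiableOn ℂ f (ball c R)) (hG : DifferentiableOn ℂ G (ball c R))
    (hfG : ∀ z ∈ ball c R, ‖f z‖ ^ 2 ≤ (G z).re) :
    Summable fun n : ℕ => (‖iteratedDeriv n f c / n.factorial‖ * R ^ n) ^ 2 := by
  have hbound (N : ℕ) {r : ℝ} (hr : r ∈ Ioo 0 R) :
      ∑ n ∈ Finset.range N, (‖iteratedDeriv n f c / n.factorial‖ * r ^ n) ^ 2 ≤ (G c).re := by
    have hsub : closedBall c r ⊆ ball c R := closedBall_subset_ball hr.2
    have hfr : DiffContOnCl ℂ f (ball c r) := (hf.mono hsub).diffContOnCl_ball subset_rfl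
    have hGr : DiffContOnCl ℂ G (ball c |r|) := by
      rw [abs_of_pos hr.1]
      exact (hG.mono hsub).diffContOnCl_ball subset_rfl
    have hsphere : sphere c r ⊆ ball c R := sphere_subset_closedBall.trans hsub
    have hfI : CircleIntegrable (fun z => ‖f z‖ ^ 2) c r :=
      ((hf.continuousOn.mono hsphere).norm.pow 2).circleIntegrable hr.1.le
    have hGI : CircleIntegrable G c r := (hG.continuousOn.mono hsphere).circleIntegrable hr.1.le
    have hGreI : CircleIntegrable (fun z => (G z).re) c r :=
      (Complex.continuous_re.comp_continuousOn (hG.continuousOn.mono hsphere)).circleIntegrable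
        hr.1.le
    calc ∑ n ∈ Finset.range N, (‖iteratedDeriv n f c / n.factorial‖ * r ^ n) ^ 2
        ≤ Real.circleAverage (fun z => ‖f z‖ ^ 2) c r :=
          sum_sq_norm_taylorCoeff_le_circleAverage hr.1 hfr N
      _ ≤ Real.circleAverage (fun z => (G z).re) c r :=
          Real.circleAverage_mono hfI hGreI fun z hz =>
            hfG z (hsphere (abs_of_pos hr.1 ▸ hz))
      _ = (Real.circleAverage G c r).re := Complex.reCLM.circleAverage_comp_comm hGI
      _ = (G c).re := by rw [hGr.circleAverage]
  refine summable_of_sum_range_le (c := (G c).re) (fun n => sq_nonneg _) fun N => ?_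
  have hcont : Tendsto
      (fun r : ℝ => ∑ n ∈ Finset.range N, (‖iteratedDeriv n f c / n.factorial‖ * r ^ n) ^ 2)
      (𝓝[<] R) (𝓝 (∑ n ∈ Finset.range N, (‖iteratedDeriv n f c / n.factorial‖ * R ^ n) ^ 2)) :=
    (Continuous.tendsto (by fun_prop) R).mono_left nhdsWithin_le_nhds
  exact le_of_tendsto hcont (eventually_of_mem (Ioo_mem_nhdsLT hR) fun r hr => hbound N hr)

theorem exists_rpow_le_mul_exp (σ : ℝ) {δ ε : ℝ} (hδ : 0 < δ) (hε : 0 < ε) :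
    ∃ C, ∀ x, δ ≤ x → x ^ σ ≤ C * Real.exp (ε * x) := by
  obtain ⟨A, hA⟩ := eventually_atTop.1
    ((tendsto_rpow_mul_exp_neg_mul_atTop_nhds_zero σ ε hε).eventually_le_const one_pos)
  have hcont : ContinuousOn (fun x : ℝ => x ^ σ * Real.exp (-ε * x)) (Icc δ A) :=
    (continuousOn_id.rpow_const fun x hx => Or.inl (hδ.trans_le hx.1).ne').mul (by fun_prop)
  obtain ⟨B, hB⟩ := isCompact_Icc.exists_bound_of_continuousOn hcont
  refine ⟨max 1 B, fun x hx => ?_⟩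
  have hmax : x ^ σ * Real.exp (-ε * x) ≤ max 1 B := by
    rcases le_total A x with hAx | hxA
    · exact (hA x hAx).trans (le_max_left _ _)
    · exact ((le_abs_self _).trans (hB x ⟨hx, hxA⟩)).trans (le_max_right _ _)
  rwa [neg_mul, Real.exp_neg, ← div_eq_mul_inv, div_le_iff₀ (Real.exp_pos _)] at hmax

theorem exists_norm_cpow_le_mul_exp_re (s : ℂ) {δ ε : ℝ} (b : ℝ) (hδ : 0 < δ) (hε : 0 < ε) :
    ∃ C, ∀ w : ℂ, δ ≤ w.re → |w.im| ≤ b → ‖w ^ s‖ ≤ C * Real.exp (ε * w.re) := by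
  obtain ⟨C, hC⟩ := exists_rpow_le_mul_exp s.re hδ hε
  have hC0 : 0 ≤ C := by
    have := (Real.rpow_pos_of_pos hδ s.re).trans_le (hC δ le_rfl)
    exact (pos_of_mul_pos_left this (Real.exp_pos _).le).le
  refine ⟨C * Real.exp (ε * b) * Real.exp (π * |s.im|), fun w hre him => ?_⟩
  have hnorm : ‖w‖ ≤ w.re + b := by
    have := Complex.norm_le_abs_re_add_abs_im w
    rw [abs_of_pos (hδ.trans_le hre)] at this
    linarith
  have harg : -(w.arg * s.im) ≤ π * |s.im| := by
    refine (neg_le_abs _).trans ?_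
    rw [abs_mul]
    gcongr
    exact Complex.abs_arg_le_pi w
  calc ‖w ^ s‖ ≤ ‖w‖ ^ s.re * Real.exp (-(w.arg * s.im)) := by
        rw [Real.exp_neg, ← div_eq_mul_inv]
        exact Complex.norm_cpow_le w s
    _ ≤ C * Real.exp (ε * ‖w‖) * Real.exp (-(w.arg * s.im)) := by
        gcongr
        exact hC _ (hre.trans (Complex.re_le_norm w))
    _ ≤ C * Real.exp (ε * (w.re + b)) * Real.exp (π * |s.im|) := by gcongr
    _ = C * Real.exp (ε * b) * Real.exp (π * |s.im|) * Real.exp (ε * w.re) := by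
        rw [mul_add, Real.exp_add]
        ring

theorem exp_re_le_two_mul_re_exp {w : ℂ} (hw : |w.im| ≤ π / 3) :
    Real.exp w.re ≤ 2 * (Complex.exp w).re := by
  have hcos : 1 / 2 ≤ Real.cos w.im := by
    rw [← Real.cos_pi_div_three, ← Real.cos_abs w.im]
    exact Real.cos_le_cos_of_nonneg_of_le_pi (abs_nonneg _) (by linarith [Real.pi_pos]) hw
  rw [Complex.exp_re]
  nlinarith [Real.exp_pos w.re]

/- The scale `π / (6 * b)` puts `2 * (π / (6 * b)) * L` in the strip `|im| ≤ π / 3`, where the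
exponential is comparable to its real part. -/
theorem summable_sq_norm_taylorCoeff_cpow_of_halfStrip {L : ℂ → ℂ} {c : ℂ} {R δ b : ℝ}
    (hR : 0 < R) (hδ : 0 < δ) (hb : 0 < b) (hL : DifferentiableOn ℂ L (ball c R))
    (hre : ∀ z ∈ ball c R, δ ≤ (L z).re) (him : ∀ z ∈ ball c R, |(L z).im| ≤ b) (s : ℂ) :
    Summable fun n : ℕ => (‖iteratedDeriv n (fun z => L z ^ s) c / n.factorial‖ * R ^ n) ^ 2 := by
  set ε : ℝ := π / (6 * b) with hε
  obtain ⟨C, hC⟩ := exists_norm_cpow_le_mul_exp_re s b hδ (show 0 < ε by positivity)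
  refine summable_sq_norm_taylorCoeff_of_sq_norm_le_re
    (G := fun z => (2 * C ^ 2 : ℝ) * Complex.exp ((2 * ε : ℝ) * L z)) hR
    (hL.cpow_const fun z hz => Or.inl (hδ.trans_le (hre z hz)))
    ((hL.const_mul _).cexp.const_mul _) fun z hz => ?_
  have hstrip : |((2 * ε : ℝ) * L z).im| ≤ π / 3 := by
    rw [Complex.im_ofReal_mul, abs_mul, abs_of_pos (by positivity)]
    calc 2 * ε * |(L z).im| ≤ 2 * ε * b := by gcongr; exact him z hz
      _ = π / 3 := by rw [hε]; field_simp; norm_num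
  calc ‖L z ^ s‖ ^ 2 ≤ (C * Real.exp (ε * (L z).re)) ^ 2 := by
        gcongr
        exact hC _ (hre z hz) (him z hz)
    _ = C ^ 2 * Real.exp ((2 * ε : ℝ) * L z).re := by
        rw [mul_pow, ← Real.exp_nat_mul, Complex.re_ofReal_mul]
        push_cast
        ring_nf
    _ ≤ C ^ 2 * (2 * (Complex.exp ((2 * ε : ℝ) * L z)).re) := by
        gcongr
        exact exp_re_le_two_mul_re_exp hstrip
    _ = ((2 * C ^ 2 : ℝ) * Complex.exp ((2 * ε : ℝ) * L z)).re := by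
        rw [Complex.re_ofReal_mul]
        ring

end SquareSummableCoefficients

section TermwiseIntegration

theorem summable_norm_div_succ_of_summable_sq_norm {E : Type*} [SeminormedAddCommGroup E]
    {a : ℕ → E}
    (ha : Summable fun n => ‖a n‖ ^ 2) : Summable fun n : ℕ => ‖a n‖ / (n + 1) := by
  have hinv : Summable fun n : ℕ => (1 / ((n : ℝ) + 1)) ^ 2 := by
    simpa using (summable_nat_add_iff 1).2 (Real.summable_nat_pow_inv.2 one_lt_two)
  refine (ha.add hinv).of_nonneg_of_le (fun n => by positivity) fun n => ?_
  rw [← mul_one_div]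
  nlinarith [sq_nonneg (‖a n‖ - 1 / ((n : ℝ) + 1)), sq_nonneg ‖a n‖,
    sq_nonneg (1 / ((n : ℝ) + 1))]

theorem setIntegral_Ioo_zero_one_pow (n : ℕ) :
    ∫ x in Ioo (0 : ℝ) 1, x ^ n = 1 / ((n : ℝ) + 1) := by
  rw [← integral_Ioc_eq_integral_Ioo, ← intervalIntegral.integral_of_le zero_le_one]
  simp

theorem hasSum_setIntegral_of_hasSum_pow_smul {E : Type*} [NormedAddCommGroup E]
    [NormedSpace ℝ E] [CompleteSpace E] {a : ℕ → E} {f : ℝ → E}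
    (hf : ∀ x ∈ Ioo (0 : ℝ) 1, HasSum (fun n => x ^ n • a n) (f x))
    (ha : Summable fun n : ℕ => ‖a n‖ / (n + 1)) :
    HasSum (fun n : ℕ => (1 / ((n : ℝ) + 1)) • a n) (∫ x in Ioo (0 : ℝ) 1, f x) := by
  have hint (n : ℕ) : IntegrableOn (fun x : ℝ => x ^ n • a n) (Ioo 0 1) :=
    (Continuous.integrableOn_Icc (by fun_prop)).mono_set Ioo_subset_Icc_self
  have hnorm (n : ℕ) : ∫ x in Ioo (0 : ℝ) 1, ‖x ^ n • a n‖ = ‖a n‖ / (n + 1) := by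
    have h : ∀ x ∈ Ioo (0 : ℝ) 1, ‖x ^ n • a n‖ = x ^ n * ‖a n‖ := fun x hx => by
      rw [norm_smul, norm_pow, Real.norm_of_nonneg hx.1.le]
    rw [setIntegral_congr_fun measurableSet_Ioo h, integral_mul_const,
      setIntegral_Ioo_zero_one_pow, one_div_mul_eq_div]
  have h := hasSum_integral_of_summable_integral_norm hint (by simpa only [hnorm] using ha)
  simp only [integral_smul_const, setIntegral_Ioo_zero_one_pow] at h
  rwa [setIntegral_congr_fun measurableSet_Ioo fun x hx => (hf x hx).tsum_eq] at h

theorem hasSum_setIntegral_taylorSeries {f : ℂ → ℂ} (hf : DifferentiableOn ℂ f (ball 0 1))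
    (ha : Summable fun n : ℕ => ‖iteratedDeriv n f 0 / n.factorial‖ / (n + 1)) :
    HasSum (fun n : ℕ => iteratedDeriv n f 0 / (n + 1).factorial) (∫ x in Ioo (0 : ℝ) 1, f x) := by
  have hseries : ∀ x ∈ Ioo (0 : ℝ) 1,
      HasSum (fun n : ℕ => x ^ n • (iteratedDeriv n f 0 / n.factorial)) (f x) := fun x hx => by
    have hx1 : (x : ℂ) ∈ ball (0 : ℂ) 1 := by simpa [abs_of_pos hx.1] using hx.2
    refine (Complex.hasSum_taylorSeries_on_ball hf hx1).congr_fun fun n => ?_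
    simp only [sub_zero, smul_eq_mul, Complex.real_smul, Complex.ofReal_pow]
    ring
  refine (hasSum_setIntegral_of_hasSum_pow_smul hseries ha).congr_fun fun n => ?_
  rw [Nat.factorial_succ, Complex.real_smul]
  push_cast
  field_simp

end TermwiseIntegration

section LaplaceIntegral

theorem integrableOn_Ioi_one_exp_neg_mul_cpow {p : ℝ} (hp : 0 < p) (s : ℂ) :
    IntegrableOn (fun u : ℝ => (Real.exp (-u * p) : ℂ) * (u : ℂ) ^ s) (Ioi 1) := by
  have hdom : IntegrableOn (fun u : ℝ => u ^ |s.re| * Real.exp (-p * u ^ (1 : ℝ))) (Ioi 1) :=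
    (integrableOn_rpow_mul_exp_neg_mul_rpow (by linarith [abs_nonneg s.re]) one_pos hp).mono_set
      (Ioi_subset_Ioi zero_le_one)
  refine Integrable.mono' hdom ?_ ?_
  · refine ContinuousOn.aestronglyMeasurable (fun u hu => ?_) measurableSet_Ioi
    have hu0 : u ≠ 0 := (one_pos.trans (mem_Ioi.1 hu)).ne'
    exact (ContinuousAt.mul (by fun_prop)
      (Complex.continuousAt_ofReal_cpow_const u s (Or.inr hu0))).continuousWithinAt
  · filter_upwards [ae_restrict_mem measurableSet_Ioi] with u (hu : 1 < u)
    rw [norm_mul, Complex.norm_real, Real.norm_of_nonneg (Real.exp_pos _).le,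
      Complex.norm_cpow_eq_rpow_re_of_pos (one_pos.trans hu), mul_comm, Real.rpow_one,
      show -u * p = -p * u by ring]
    gcongr
    · exact hu.le
    · exact le_abs_self _

theorem image_one_sub_log_div_Ioo {p : ℝ} (hp : 0 < p) :
    (fun x : ℝ => 1 - Real.log (1 - x) / p) '' Ioo 0 1 = Ioi 1 := by
  ext u
  simp only [mem_image, mem_Ioi, mem_Ioo]
  constructor
  · rintro ⟨x, ⟨hx0, hx1⟩, rfl⟩
    have : Real.log (1 - x) / p < 0 :=
      div_neg_of_neg_of_pos (Real.log_neg (by linarith) (by linarith)) hp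
    linarith
  · intro hu
    refine ⟨1 - Real.exp (-(p * (u - 1))), ⟨?_, ?_⟩, ?_⟩
    · have := Real.exp_lt_one_iff.2 (neg_neg_of_pos (mul_pos hp (sub_pos.2 hu)))
      linarith
    · linarith [Real.exp_pos (-(p * (u - 1)))]
    · rw [sub_sub_cancel, Real.log_exp]
      field_simp
      ring

theorem setIntegral_Ioi_one_exp_neg_mul_smul {E : Type*} [NormedAddCommGroup E] [NormedSpace ℝ E]
    {p : ℝ} (hp : 0 < p) (h : ℝ → E) :
    ∫ u in Ioi (1 : ℝ), Real.exp (-u * p) • h u =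
      (Real.exp (-p) / p) • ∫ x in Ioo (0 : ℝ) 1, h (1 - Real.log (1 - x) / p) := by
  have hderiv : ∀ x ∈ Ioo (0 : ℝ) 1, HasDerivAt (fun x : ℝ => 1 - Real.log (1 - x) / p)
      (1 / (p * (1 - x))) x := fun x hx => by
    have hx0 : 1 - x ≠ 0 := (sub_pos.2 hx.2).ne'
    refine (((((hasDerivAt_id' x).const_sub 1).log hx0).div_const p).const_sub 1).congr_deriv ?_
    field_simp
  have hmono : MonotoneOn (fun x : ℝ => 1 - Real.log (1 - x) / p) (Ioo 0 1) :=
    fun x _ y hy hxy => by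
      have : 0 < 1 - y := sub_pos.2 hy.2
      dsimp only
      gcongr
  rw [← image_one_sub_log_div_Ioo hp, integral_image_eq_integral_deriv_smul_of_monotoneOn
    measurableSet_Ioo (fun x hx => (hderiv x hx).hasDerivWithinAt) hmono, ← integral_smul]
  refine setIntegral_congr_fun measurableSet_Ioo fun x hx => ?_
  have hx0 : 0 < 1 - x := sub_pos.2 hx.2
  have hexp : -(1 - Real.log (1 - x) / p) * p = -p + Real.log (1 - x) := by field_simp; ring
  rw [hexp, Real.exp_add, Real.exp_log hx0, smul_smul]
  congr 1
  field_simp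

end LaplaceIntegral

/-- The function `1 - log (1 - z) / p`. Along `(0, 1)` it is the substitution `u = u(x)` that turns
`∫₁^∞ e^{-up} h(u) du` into `(e^{-p} / p) ∫₀¹ h(u(x)) dx`, and for `p > log 2` it maps the unit disc
into a half-strip in the right half-plane. -/
noncomputable def halfStripMap (p : ℝ) (z : ℂ) : ℂ := 1 - Complex.log (1 - z) / p

section HalfStripMap

variable {p : ℝ} {z : ℂ}

theorem halfStripMap_zero (p : ℝ) : halfStripMap p 0 = 1 := by simp [halfStripMap]

theorem halfStripMap_ofReal (p : ℝ) {x : ℝ} (hx : x < 1) :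
    halfStripMap p x = (1 - Real.log (1 - x) / p : ℝ) := by
  simp [halfStripMap, Complex.ofReal_log (sub_pos.2 hx).le]

theorem re_one_sub_pos (hz : z ∈ ball (0 : ℂ) 1) : 0 < (1 - z).re := by
  simpa using (Complex.re_le_norm z).trans_lt (mem_ball_zero_iff.1 hz)

theorem hasDerivAt_halfStripMap (p : ℝ) (hz : z ∈ ball (0 : ℂ) 1) :
    HasDerivAt (halfStripMap p) (1 / (p * (1 - z))) z := by
  have hlog := ((hasDerivAt_id' z).const_sub 1).clog (Or.inl (re_one_sub_pos hz))
  refine ((hlog.div_const (p : ℂ)).const_sub 1).congr_deriv ?_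
  simp only [div_eq_mul_inv, mul_inv]
  ring

theorem one_sub_log_two_div_le_re_halfStripMap (hp : 0 < p) (hz : z ∈ ball (0 : ℂ) 1) :
    1 - Real.log 2 / p ≤ (halfStripMap p z).re := by
  have hpos : 0 < ‖1 - z‖ := (re_one_sub_pos hz).trans_le (Complex.re_le_norm _)
  have hle : ‖1 - z‖ ≤ 2 := by
    have := norm_sub_le 1 z
    rw [norm_one] at this
    linarith [mem_ball_zero_iff.1 hz]
  have hre : (halfStripMap p z).re = 1 - Real.log ‖1 - z‖ / p := by
    simp [halfStripMap, Complex.div_ofReal_re, Complex.log_re]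
  rw [hre]
  gcongr

theorem re_halfStripMap_pos (hp : Real.log 2 < p) (hz : z ∈ ball (0 : ℂ) 1) :
    0 < (halfStripMap p z).re := by
  have hp0 : 0 < p := (Real.log_pos one_lt_two).trans hp
  have : Real.log 2 / p < 1 := (div_lt_one hp0).2 hp
  linarith [one_sub_log_two_div_le_re_halfStripMap hp0 hz]

theorem abs_im_halfStripMap_le (hp : 0 < p) (hz : z ∈ ball (0 : ℂ) 1) :
    |(halfStripMap p z).im| ≤ π / 2 / p := by
  have him : |(halfStripMap p z).im| = |(1 - z).arg| / p := by
    simp [halfStripMap, Complex.div_ofReal_im, Complex.log_im, abs_div, abs_of_pos hp]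
  rw [him]
  gcongr
  exact Complex.abs_arg_le_pi_div_two_iff.2 (re_one_sub_pos hz).le

theorem differentiableOn_halfStripMap_cpow (hp : Real.log 2 < p) (s : ℂ) :
    DifferentiableOn ℂ (fun z => halfStripMap p z ^ s) (ball 0 1) := fun _ hz =>
  ((hasDerivAt_halfStripMap p hz).differentiableAt.cpow_const
    (Or.inl (re_halfStripMap_pos hp hz))).differentiableWithinAt

theorem iteratedDeriv_halfStripMap_cpow_zero (hp : Real.log 2 < p) (s : ℂ) (n : ℕ) :
    iteratedDeriv n (fun z => halfStripMap p z ^ s) 0 = ∑ i ∈ Finset.range (n + 1),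
      (Nat.stirlingFirst n i : ℂ) * ((descPochhammer ℂ i).eval s / (p : ℂ) ^ i) := by
  set φ : ℕ → ℂ → ℂ := fun i z =>
    (descPochhammer ℂ i).eval s / (p : ℂ) ^ i * halfStripMap p z ^ (s - i) with hφ
  have hφ0 : φ 0 = fun z => halfStripMap p z ^ s := by simp [hφ]
  have hderiv : ∀ i, ∀ z ∈ ball (0 : ℂ) 1, HasDerivAt (φ i) (φ (i + 1) z / (1 - z)) z := by
    intro i z hz
    refine (((hasDerivAt_halfStripMap p hz).cpow_const (c := s - i)
      (Or.inl (re_halfStripMap_pos hp hz))).const_mul _).congr_deriv ?_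
    simp only [hφ, descPochhammer_succ_eval, Nat.cast_succ, ← sub_sub, pow_succ, div_eq_mul_inv,
      mul_inv]
    ring
  rw [← hφ0, iteratedDeriv_eqOn_sum_stirlingFirst_div isOpen_ball (by simp) hderiv n
    (mem_ball_self one_pos)]
  simp [hφ, halfStripMap_zero]

theorem iteratedDeriv_succ_halfStripMap_cpow_zero (hp : Real.log 2 < p) (s : ℂ) (n : ℕ) :
    iteratedDeriv (n + 1) (fun z => halfStripMap p z ^ s) 0 = stirlingG (n + 1) s p := by
  rw [iteratedDeriv_halfStripMap_cpow_zero hp, Finset.range_eq_Ico,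
    Finset.sum_eq_sum_Ico_succ_bot (by omega), Nat.stirlingFirst_succ_zero, stirlingG]
  simp only [Nat.cast_zero, zero_mul, zero_add]
  rfl

theorem summable_norm_taylorCoeff_halfStripMap_cpow_div_succ (hp : Real.log 2 < p) (s : ℂ) :
    Summable fun n : ℕ =>
      ‖iteratedDeriv n (fun z => halfStripMap p z ^ s) 0 / n.factorial‖ / (n + 1) := by
  have hp0 : 0 < p := (Real.log_pos one_lt_two).trans hp
  have hsq := summable_sq_norm_taylorCoeff_cpow_of_halfStrip one_pos
    (sub_pos.2 ((div_lt_one hp0).2 hp)) (by positivity)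
    (fun z hz => (hasDerivAt_halfStripMap p hz).differentiableAt.differentiableWithinAt)
    (fun z hz => one_sub_log_two_div_le_re_halfStripMap hp0 hz)
    (fun z hz => abs_im_halfStripMap_le hp0 hz) s
  exact summable_norm_div_succ_of_summable_sq_norm (by simpa only [one_pow, mul_one] using hsq)

theorem summable_norm_stirlingG_div_factorial (hp : Real.log 2 < p) (s : ℂ) :
    Summable fun n : ℕ => ‖stirlingG (n + 1) s p / ((n + 1 + 1).factorial : ℂ)‖ := by
  refine ((summable_nat_add_iff 1).2
    (summable_norm_taylorCoeff_halfStripMap_cpow_div_succ hp s)).congr fun n => ?_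
  rw [iteratedDeriv_succ_halfStripMap_cpow_zero hp, Nat.factorial_succ (n + 1)]
  simp only [norm_div, Complex.norm_natCast]
  push_cast
  field_simp

theorem setIntegral_halfStripMap_cpow_eq_one_add_tsum (hp : Real.log 2 < p) (s : ℂ) :
    ∫ x in Ioo (0 : ℝ) 1, halfStripMap p x ^ s =
      1 + ∑' n : ℕ, stirlingG (n + 1) s p / ((n + 1 + 1).factorial : ℂ) := by
  have hsum := hasSum_setIntegral_taylorSeries (differentiableOn_halfStripMap_cpow hp s)
    (summable_norm_taylorCoeff_halfStripMap_cpow_div_succ hp s)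
  rw [← hsum.tsum_eq, hsum.summable.tsum_eq_zero_add]
  simp only [iteratedDeriv_succ_halfStripMap_cpow_zero hp, iteratedDeriv_zero, halfStripMap_zero,
    Complex.one_cpow, zero_add, Nat.factorial_one, Nat.cast_one, div_one]

end HalfStripMap

theorem mainTheorem1_general (p : ℝ) (hp : Real.log 2 < p) (s : ℂ) :
    Summable (fun n : ℕ => ‖stirlingG (n + 1) s p / ((n + 1 + 1).factorial : ℂ)‖) ∧
    IntegrableOn (fun u : ℝ => (Real.exp (-u * p) : ℂ) * (u : ℂ) ^ s) (Ioi 1) ∧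
    ∫ u in Ioi (1 : ℝ), (Real.exp (-u * p) : ℂ) * (u : ℂ) ^ s =
      (Real.exp (-p) : ℂ) / (p : ℂ) *
        (1 + ∑' n : ℕ, stirlingG (n + 1) s p / ((n + 1 + 1).factorial : ℂ)) := by
  have hp0 : 0 < p := (Real.log_pos one_lt_two).trans hp
  refine ⟨summable_norm_stirlingG_div_factorial hp s,
    integrableOn_Ioi_one_exp_neg_mul_cpow hp0 s, ?_⟩
  have hsubst : ∫ x in Ioo (0 : ℝ) 1, ((1 - Real.log (1 - x) / p : ℝ) : ℂ) ^ s =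
      ∫ x in Ioo (0 : ℝ) 1, halfStripMap p x ^ s :=
    setIntegral_congr_fun measurableSet_Ioo fun x hx => by
      simp only [halfStripMap_ofReal p hx.2]
  rw [← setIntegral_halfStripMap_cpow_eq_one_add_tsum hp s, ← hsubst]
  simpa only [Complex.real_smul, Complex.ofReal_div] using
    setIntegral_Ioi_one_exp_neg_mul_smul hp0 fun u : ℝ => (u : ℂ) ^ s

theorem mainTheorem1 (p : ℝ) (hp : 1 ≤ p) (s : ℂ) :
    Summable (fun n : ℕ => ‖stirlingG (n + 1) s p / ((n + 1 + 1).factorial : ℂ)‖) ∧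
    MeasureTheory.IntegrableOn
      (fun u : ℝ => (Real.exp (-u * p) : ℂ) * (u : ℂ) ^ s) (Set.Ioi 1) ∧
    ∫ u in Set.Ioi (1 : ℝ), (Real.exp (-u * p) : ℂ) * (u : ℂ) ^ s =
      (Real.exp (-p) : ℂ) / (p : ℂ) *
        (1 + ∑' n : ℕ, stirlingG (n + 1) s p / ((n + 1 + 1).factorial : ℂ)) :=
  mainTheorem1_general p (by linarith [Real.log_two_lt_d9]) s
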